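/- For a permutation $\pi=\pi_1\cdots\pi_n$ of $\{1,\dots,n\}$ and an entry $k$ of $\pi$, let $s_\pi(k)$ be the longest string of consecutive entries of $\pi$ that contains $k$ and all of whose entries are $\ge k$, and let $g_\pi(k)$ be the permutation obtained by rescaling $s_\pi(k)$. A permutation contains a pattern $\sigma$ if it has a subsequence order-isomorphic to $\sigma$; otherwise it avoids $\sigma$. Let $Av_n(\sigma)$ be the set of permutations of size $n$ avoiding $\sigma$, and let $Av_n(\sigma;k)$ be the set of permutations $\pi$ of size $n$ such that $\pi$ avoids $\sigma$ if and only if $g_\pi(k)$ avoids $\sigma$. Let $\sigma$ be any permutation pattern. Then the limit $$h_\sigma=\lim_{n\to\infty}\sum_{i=1}^{n-1-|\sigma|}\frac{|Av_i(\sigma)|}{(i-1)!}$$ exists and is finite, and for a uniform random permutation $\pi$ of size $n$, as $n\to\infty$, $$\mathrm{Prob}\bigl(\pi\notin Av_n(\sigma;2)\bigr)\sim\frac{2h_\sigma}{n^2} \qquad\text{and}\qquad \mathrm{Prob}\bigl(\pi\text{ contains }\sigma\text{ and }g_\pi(2)\text{ avoids }\sigma\bigr)\sim\frac{2h_\sigma}{n^2},$$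 where $a_n\sim b_n$ means $a_n-b_n=o(b_n)$ (so for $|\sigma|\le 1$, where $h_\sigma=0$, it means that $a_n=0$ for all large $n$). -/

import Mathlib

namespace SubPerm

/-- A permutation of size `n` is an element of `Equiv.Perm (Fin n)`; it is read in one-line notation
with the usual entries `1, …, n`: the entry of `π` at position `j` is `π j + 1`. -/
def entry {n : ℕ} (π : Equiv.Perm (Fin n)) (j : Fin n) : ℕ := (π j : ℕ) + 1

/-- `π` contains the pattern `σ`: some sub-sequence of `π` is order-isomorphic to `σ`. -/
def Contains {k n : ℕ} (σ : Equiv.Perm (Fin k)) (π : Equiv.Perm (Fin n)) : Prop :=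
  ∃ f : Fin k → Fin n, StrictMono f ∧ ∀ i j : Fin k, σ i < σ j ↔ π (f i) < π (f j)

/-- The set of permutations of size `n` avoiding `σ`. -/
def Av {k : ℕ} (σ : Equiv.Perm (Fin k)) (n : ℕ) : Set (Equiv.Perm (Fin n)) :=
  {π | ¬ Contains σ π}

/-- The positions of the biggest sub-string of `π` that contains the entry `k` and all of whose
entries are at least `k`: those `j` such that no entry between `k` and position `j` (inclusive)
is smaller than `k`. (It is empty if `k` is not an entry of `π`.) -/
def subPositions {n : ℕ} (π : Equiv.Perm (Fin n)) (k : ℕ) : Finset (Fin n) :=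
  {j | ∃ p : Fin n, entry π p = k ∧ ∀ l ∈ Finset.uIcc p j, k ≤ entry π l}

/-- `subPositions π k` is indeed the biggest set of consecutive positions that contains the position
of `k` and carries only entries `≥ k`. -/
theorem isGreatest_subPositions {n : ℕ} (π : Equiv.Perm (Fin n)) (k : ℕ) (p : Fin n)
    (hp : entry π p = k) :
    IsGreatest {S : Finset (Fin n) | p ∈ S ∧ (S : Set (Fin n)).OrdConnected ∧
      ∀ j ∈ S, k ≤ entry π j} (subPositions π k) := by
  have huniq : ∀ q, entry π q = k → q = p := by
    intro q hq
    apply π.injective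
    apply Fin.ext
    simp only [entry] at hp hq
    omega
  have hmem : ∀ j, j ∈ subPositions π k ↔ ∀ l ∈ Finset.uIcc p j, k ≤ entry π l := by
    intro j
    simp only [subPositions, Finset.mem_filter, Finset.mem_univ, true_and]
    constructor
    · rintro ⟨q, hq, h⟩
      rwa [← huniq q hq]
    · intro h
      exact ⟨p, hp, h⟩
  refine ⟨⟨?_, ⟨?_⟩, ?_⟩, ?_⟩
  · rw [hmem]
    intro l hl
    simp only [Finset.uIcc_self, Finset.mem_singleton] at hl
    rw [hl, hp]
  · intro x hx y hy z hz
    simp only [Finset.mem_coe, hmem, Finset.mem_uIcc', Set.mem_Icc] at hx hy hz ⊢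
    intro l hl
    rcases le_total p z with h | h
    · exact hy l (by grind)
    · exact hx l (by grind)
  · intro j hj
    exact (hmem j).1 hj j Finset.right_mem_uIcc
  · rintro S ⟨h1, h2, h3⟩ j hj
    rw [hmem]
    intro l hl
    apply h3
    have := h2.uIcc_subset (Finset.mem_coe.2 h1) (Finset.mem_coe.2 hj)
    exact Finset.mem_coe.1 (this (by simpa [← Finset.coe_uIcc] using hl))

/-- The permutation obtained by rescaling the sub-sequence of `π` at the positions in `S`:
the positions, and the values of `π` there, are renumbered increasingly. -/
def rescale {n : ℕ} (π : Equiv.Perm (Fin n)) (S : Finset (Fin n)) : Equiv.Perm (Fin S.card) :=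
  (S.orderIsoOfFin rfl).toEquiv.trans
    ((π.subtypeEquiv (q := fun b => b ∈ S.map π.toEmbedding) (by simp)).trans
      ((S.map π.toEmbedding).orderIsoOfFin (Finset.card_map _)).symm.toEquiv)

/-- The sub-permutation of `π` generated by the entry `k` (for `1 ≤ k ≤ n`). -/
def subPerm {n : ℕ} (π : Equiv.Perm (Fin n)) (k : ℕ) :
    Equiv.Perm (Fin (subPositions π k).card) :=
  rescale π (subPositions π k)

/-- The set of permutations `π` of size `n` such that `π` avoids `σ` if and only if the
sub-permutation of `π` generated by the entry `k` avoids `σ`. -/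
def AvSub {s : ℕ} (σ : Equiv.Perm (Fin s)) (k n : ℕ) : Set (Equiv.Perm (Fin n)) :=
  {π | π ∈ Av σ n ↔ subPerm π k ∈ Av σ (subPositions π k).card}

/-- The probability that a uniform random permutation of size `n` lies in `A`. -/
noncomputable def prob {n : ℕ} (A : Set (Equiv.Perm (Fin n))) : ℝ :=
  (A.ncard : ℝ) / (Nat.factorial n : ℝ)

end SubPerm

/-! Since `g_π(2)` is a pattern of `π`, the avoidance equivalence fails only when `π` contains `σ`
and `g_π(2)` avoids it, so both probabilities coincide. The entry 1 is the only one below 2, hence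
`g_π(2)` rescales everything on the side of 1 where 2 lies. Given the position of 1 and the side of
2, that rescaling is uniform (`ncard_rescale_mem_mul`). Write `a_i = |Av_i(σ)|/i!`. A side of length
`i` contributes `i · a_i · (n-2)!` permutations, and each length occurs once on the left and once on
the right. So the probability is exactly `2 ∑_{i<n} i a_i / (n(n-1)) - a_n`.

Disjoint blocks of positions rescale independently, so `a_{n+m} ≤ a_n a_m`; with `a_s < 1` this
gives exponential decay. Thus `n² a_n → 0` and `∑ i a_i` converges, its sum being `h_σ` because `i
a_i = |Av_i(σ)|/(i-1)!`. -/

namespace SubPerm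

open Filter Topology

/-! ### Equidistribution of rescalings -/

/-- A permutation is determined by the relative order of its entries. -/
theorem perm_eq_of_lt_iff {k : ℕ} (ρ τ : Equiv.Perm (Fin k))
    (h : ∀ a b, ρ a < ρ b ↔ τ a < τ b) : ρ = τ := by
  let e : Fin k ≃o Fin k :=
    { toEquiv := τ.symm.trans ρ
      map_rel_iff' := by
        intro a b
        have := h (τ.symm b) (τ.symm a)
        simp only [Equiv.apply_symm_apply] at this
        simp only [Equiv.trans_apply]
        rw [← not_lt, this, not_lt] }
  -- A finite chain has no order automorphism but the identity.
  have he : e = OrderIso.refl _ := Subsingleton.elim _ _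
  ext a
  have := DFunLike.congr_fun he (τ a)
  simp only [e, OrderIso.refl_apply] at this
  change ρ (τ.symm (τ a)) = τ a at this
  rw [← this, Equiv.symm_apply_apply]

theorem rescale_lt_iff {n : ℕ} (π : Equiv.Perm (Fin n)) (S : Finset (Fin n)) (a b : Fin S.card) :
    rescale π S a < rescale π S b ↔ π (S.orderEmbOfFin rfl a) < π (S.orderEmbOfFin rfl b) := by
  simp only [rescale, Equiv.trans_apply]
  exact ((S.map π.toEmbedding).orderIsoOfFin (Finset.card_map _)).symm.lt_iff_lt

/-- The permutation of `Fin n` that acts on the positions in `S` as `τ`. -/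
def extendPerm {n : ℕ} (S : Finset (Fin n)) (τ : Equiv.Perm (Fin S.card)) : Equiv.Perm (Fin n) :=
  τ.extendDomain (S.orderIsoOfFin rfl).toEquiv

theorem extendPerm_orderEmbOfFin {n : ℕ} (S : Finset (Fin n)) (τ : Equiv.Perm (Fin S.card))
    (a : Fin S.card) :
    extendPerm S τ (S.orderEmbOfFin rfl a) = S.orderEmbOfFin rfl (τ a) :=
  Equiv.Perm.extendDomain_apply_image τ (S.orderIsoOfFin rfl).toEquiv a

theorem extendPerm_of_notMem {n : ℕ} (S : Finset (Fin n)) (τ : Equiv.Perm (Fin S.card))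
    {j : Fin n} (hj : j ∉ S) : extendPerm S τ j = j :=
  Equiv.Perm.extendDomain_apply_not_subtype τ (S.orderIsoOfFin rfl).toEquiv hj

/-- Permuting positions inside `S` acts on the rescaling by right translation, a simply transitive
action; this is the source of uniformity. -/
theorem rescale_mul_extendPerm {n : ℕ} (π : Equiv.Perm (Fin n)) (S : Finset (Fin n))
    (τ : Equiv.Perm (Fin S.card)) : rescale (π * extendPerm S τ) S = rescale π S * τ := by
  apply perm_eq_of_lt_iff
  intro a b
  rw [rescale_lt_iff, Equiv.Perm.mul_apply, Equiv.Perm.mul_apply, Equiv.Perm.mul_apply,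
    Equiv.Perm.mul_apply, rescale_lt_iff, extendPerm_orderEmbOfFin, extendPerm_orderEmbOfFin]

/-- `E` is invariant under permuting the positions in `S`. -/
def InvariantOn {n : ℕ} (S : Finset (Fin n)) (E : Set (Equiv.Perm (Fin n))) : Prop :=
  ∀ g : Equiv.Perm (Fin n), (∀ j ∉ S, g j = j) → ∀ π, π * g ∈ E ↔ π ∈ E

open scoped Classical in
/-- The rescaling of `π` on `S` is equidistributed when `π` runs through a set that is invariant
under permuting the positions in `S`. -/
theorem ncard_rescale_mem_mul {n : ℕ} (S : Finset (Fin n)) (E : Set (Equiv.Perm (Fin n)))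
    (hE : InvariantOn S E) (A : Set (Equiv.Perm (Fin S.card))) :
    {π ∈ E | rescale π S ∈ A}.ncard * (S.card).factorial = A.ncard * E.ncard := by
  have h1 : ∀ τ : Equiv.Perm (Fin S.card),
      {π ∈ E | rescale (π * extendPerm S τ) S ∈ A}.ncard = {π ∈ E | rescale π S ∈ A}.ncard := by
    intro τ
    have : {π ∈ E | rescale π S ∈ A} =
        (Equiv.mulRight (extendPerm S τ)) '' {π ∈ E | rescale (π * extendPerm S τ) S ∈ A} := by
      ext π
      rw [Equiv.image_eq_preimage_symm]
      have h := hE (extendPerm S τ) (fun j hj => extendPerm_of_notMem S τ hj)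
        (π * (extendPerm S τ)⁻¹)
      simp only [inv_mul_cancel_right] at h
      simp [h]
    rw [this, Set.ncard_image_of_injective _ (Equiv.injective _)]
  have h2 : ∀ π : Equiv.Perm (Fin n),
      {τ | rescale (π * extendPerm S τ) S ∈ A}.ncard = A.ncard := by
    intro π
    simp only [rescale_mul_extendPerm]
    exact Set.ncard_preimage_of_injective_subset_range (f := fun τ => rescale π S * τ)
      (mul_right_injective _) (fun x _ => ⟨(rescale π S)⁻¹ * x, by simp⟩)
  -- Double counting of pairs `(τ, π)`: the count is independent of `τ` because `E` is invariant,
  -- and equals `|A|` for each `π` because left translation is bijective.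
  have key : ∑ τ : Equiv.Perm (Fin S.card), {π ∈ E | rescale (π * extendPerm S τ) S ∈ A}.ncard =
      ∑ π ∈ E.toFinset, {τ | rescale (π * extendPerm S τ) S ∈ A}.ncard := by
    have := Finset.sum_card_bipartiteAbove_eq_sum_card_bipartiteBelow
      (s := (Finset.univ : Finset (Equiv.Perm (Fin S.card)))) (t := E.toFinset)
      (fun τ π => rescale (π * extendPerm S τ) S ∈ A)
    convert this using 2 with τ _ π _
    · rw [Set.ncard_eq_toFinset_card']
      congr 1
      ext; simp [Finset.bipartiteAbove]
    · rw [Set.ncard_eq_toFinset_card']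
      congr 1
      ext; simp [Finset.bipartiteBelow]
  simp only [h1, h2, Finset.sum_const, smul_eq_mul] at key
  rw [Finset.card_univ, Fintype.card_perm, Fintype.card_fin, ← Set.ncard_eq_toFinset_card'] at key
  rw [mul_comm, key, mul_comm]

/-! ### Counting permutations with prescribed values -/

theorem ncard_univ_perm (n : ℕ) : (Set.univ : Set (Equiv.Perm (Fin n))).ncard = n.factorial := by
  rw [Set.ncard_univ, Nat.card_eq_fintype_card, Fintype.card_perm, Fintype.card_fin]

theorem ncard_apply_eq_apply_eq {n : ℕ} {p q a b : Fin n} (hpq : p ≠ q) (hab : a ≠ b) :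
    {π : Equiv.Perm (Fin n) | π p = a ∧ π q = b}.ncard = (n - 2).factorial := by
  classical
  obtain ⟨g, hgp, hgq⟩ : ∃ g : Equiv.Perm (Fin n), g p = a ∧ g q = b := by
    refine ⟨Equiv.swap (Equiv.swap p a q) b * Equiv.swap p a, ?_, by simp⟩
    rw [Equiv.Perm.mul_apply, Equiv.swap_apply_left, Equiv.swap_apply_of_ne_of_ne _ hab]
    intro h
    have := (Equiv.swap p a).injective (h.symm.trans (Equiv.swap_apply_left p a).symm)
    exact hpq this.symm
  -- A left coset of the pointwise stabilizer of `{p, q}`.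
  have h1 : {π : Equiv.Perm (Fin n) | π p = a ∧ π q = b} = (Equiv.mulLeft g) ''
      {f | ∀ j, ¬ (j ≠ p ∧ j ≠ q) → f j = j} := by
    ext π
    rw [Equiv.image_eq_preimage_symm]
    simp only [Set.mem_ofPred_eq, Set.mem_preimage, Equiv.mulLeft_symm_apply, Equiv.Perm.mul_apply,
      Equiv.Perm.inv_eq_iff_eq]
    constructor
    · rintro ⟨rfl, rfl⟩ j hj
      by_cases hp : j = p
      · rw [hp, hgp]
      · have hq : j = q := by tauto
        rw [hq, hgq]
    · intro h
      exact ⟨(h p (by simp)).trans hgp, (h q (by simp)).trans hgq⟩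
  rw [h1, Set.ncard_image_of_injective _ (Equiv.injective _), ← Nat.card_coe_set_eq]
  refine (Nat.card_congr (Equiv.Perm.subtypeEquivSubtypePerm (fun j => j ≠ p ∧ j ≠ q))).symm.trans ?_
  rw [Nat.card_perm, Nat.card_eq_fintype_card, Fintype.card_subtype]
  congr 1
  have : (Finset.univ.filter fun j : Fin n => j ≠ p ∧ j ≠ q) = ({p, q} : Finset (Fin n))ᶜ := by
    ext; simp
  rw [this, Finset.card_compl, Finset.card_pair hpq, Fintype.card_fin]

theorem ncard_biUnion_finset {ι α : Type*} [Finite α] (S : Finset ι) {f : ι → Set α}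
    (h : (S : Set ι).PairwiseDisjoint f) : (⋃ i ∈ S, f i).ncard = ∑ i ∈ S, (f i).ncard := by
  have := S.finite_toSet.ncard_biUnion (fun i _ => (f i).toFinite) h
  rwa [finsum_mem_coe_finset] at this

/-- The number of permutations with value `a` at `p` and value `b` at a position in `S`. -/
theorem ncard_apply_eq_symm_mem {n : ℕ} {p a b : Fin n} (hab : a ≠ b) (S : Finset (Fin n))
    (hp : p ∉ S) :
    {π : Equiv.Perm (Fin n) | π p = a ∧ π.symm b ∈ S}.ncard = S.card * (n - 2).factorial := by
  have h : {π : Equiv.Perm (Fin n) | π p = a ∧ π.symm b ∈ S} =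
      ⋃ q ∈ S, {π : Equiv.Perm (Fin n) | π p = a ∧ π q = b} := by
    ext π
    simp only [Set.mem_ofPred_eq, Set.mem_iUnion, exists_prop]
    constructor
    · rintro ⟨h1, h2⟩
      exact ⟨_, h2, h1, by simp⟩
    · rintro ⟨q, h1, h2, rfl⟩
      exact ⟨h2, by simpa using h1⟩
  rw [h, ncard_biUnion_finset S,
    Finset.sum_congr rfl (fun q hq => ncard_apply_eq_apply_eq
      (by rintro rfl; exact hp hq) hab), Finset.sum_const, smul_eq_mul]
  intro q _ q' _ hne
  rw [Function.onFun, Set.disjoint_left]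
  rintro π ⟨_, h1⟩ ⟨_, h2⟩
  exact hne (π.injective (h1.trans h2.symm))

/-! ### Containment, and exponential decay of the proportion of avoiders -/

theorem contains_of_contains_rescale {s n : ℕ} {σ : Equiv.Perm (Fin s)} {π : Equiv.Perm (Fin n)}
    {S : Finset (Fin n)} (h : Contains σ (rescale π S)) : Contains σ π := by
  obtain ⟨f, hf, hlt⟩ := h
  refine ⟨fun i => S.orderEmbOfFin rfl (f i), (S.orderEmbOfFin rfl).strictMono.comp hf, ?_⟩
  intro i j
  rw [hlt, rescale_lt_iff]

theorem contains_of_contains_subPerm {s n k : ℕ} {σ : Equiv.Perm (Fin s)}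
    {π : Equiv.Perm (Fin n)} (h : Contains σ (subPerm π k)) : Contains σ π :=
  contains_of_contains_rescale h

theorem contains_self {s : ℕ} (σ : Equiv.Perm (Fin s)) : Contains σ σ :=
  ⟨id, strictMono_id, fun _ _ => Iff.rfl⟩

theorem contains_of_le_one {s n : ℕ} (hs : s ≤ 1) (hn : 1 ≤ n) (σ : Equiv.Perm (Fin s))
    (π : Equiv.Perm (Fin n)) : Contains σ π := by
  have : Subsingleton (Fin s) := Fin.subsingleton_iff_le_one.2 hs
  refine ⟨fun _ => ⟨0, hn⟩, fun i j hij => absurd hij (by simp [Subsingleton.elim i j]), ?_⟩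
  intro i j
  simp [Subsingleton.elim i j]

/-- The proportion of permutations of size `n` avoiding `σ`. -/
noncomputable def avoidProb {s : ℕ} (σ : Equiv.Perm (Fin s)) (n : ℕ) : ℝ :=
  ((Av σ n).ncard : ℝ) / (n.factorial : ℝ)

theorem avoidProb_nonneg {s : ℕ} (σ : Equiv.Perm (Fin s)) (n : ℕ) : 0 ≤ avoidProb σ n := by
  unfold avoidProb; positivity

theorem avoidProb_le_one {s : ℕ} (σ : Equiv.Perm (Fin s)) (n : ℕ) : avoidProb σ n ≤ 1 := by
  unfold avoidProb
  rw [div_le_one (by positivity), ← ncard_univ_perm]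
  exact_mod_cast Set.ncard_le_ncard (Set.subset_univ _) (Set.toFinite _)

/-- Among the permutations in a set invariant on `S`, the proportion whose rescaling on `S` avoids
`σ` is the same as among all permutations of that size. -/
theorem ncard_rescale_mem_Av {s n : ℕ} (σ : Equiv.Perm (Fin s)) (S : Finset (Fin n))
    (E : Set (Equiv.Perm (Fin n))) (hE : InvariantOn S E) :
    ({π ∈ E | rescale π S ∈ Av σ S.card}.ncard : ℝ) = avoidProb σ S.card * E.ncard := by
  have := ncard_rescale_mem_mul S E hE (Av σ S.card)
  unfold avoidProb
  field_simp
  exact_mod_cast this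

theorem avoidProb_self_lt_one {s : ℕ} (σ : Equiv.Perm (Fin s)) : avoidProb σ s < 1 := by
  unfold avoidProb
  rw [div_lt_one (by positivity), ← ncard_univ_perm]
  norm_cast
  apply Set.ncard_lt_ncard _ (Set.toFinite _)
  rw [Set.ssubset_univ_iff]
  intro h
  have : σ ∈ Av σ s := h ▸ Set.mem_univ _
  exact this (contains_self σ)

theorem rescale_mul_of_fix {n : ℕ} (S : Finset (Fin n)) (π g : Equiv.Perm (Fin n))
    (hg : ∀ j ∈ S, g j = j) : rescale (π * g) S = rescale π S := by
  apply perm_eq_of_lt_iff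
  intro a b
  rw [rescale_lt_iff, rescale_lt_iff, Equiv.Perm.mul_apply, Equiv.Perm.mul_apply,
    hg _ (S.orderEmbOfFin_mem rfl a), hg _ (S.orderEmbOfFin_mem rfl b)]

/-- An avoider avoids `σ` on the first `n` and on the last `m` positions, and these two events are
independent. -/
theorem avoidProb_add_le {s : ℕ} (σ : Equiv.Perm (Fin s)) (n m : ℕ) :
    avoidProb σ (n + m) ≤ avoidProb σ m * avoidProb σ n := by
  let S : Finset (Fin (n + m)) := Finset.univ.map (Fin.castAddEmb m)
  have hS : S.card = n := by simp [S]
  have hSc : Sᶜ.card = m := by rw [Finset.card_compl, hS]; simp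
  have h1 := ncard_rescale_mem_Av σ S Set.univ (by intro g _ π; simp)
  -- Independence: the event on `S` is invariant under permuting positions in `Sᶜ`.
  have h2 := ncard_rescale_mem_Av σ Sᶜ {π ∈ Set.univ | rescale π S ∈ Av σ S.card} (by
    intro g hg π
    simp only [Set.mem_ofPred_eq, Set.mem_univ, true_and]
    rw [rescale_mul_of_fix S π g (fun j hj => hg j (by simpa using hj))])
  rw [h1, ncard_univ_perm] at h2
  have hR : avoidProb σ Sᶜ.card * (avoidProb σ S.card * (n + m).factorial) =
      avoidProb σ m * (avoidProb σ n * (n + m).factorial) := by rw [hS, hSc]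
  rw [hR] at h2
  have h3 : Av σ (n + m) ⊆ {π ∈ {π ∈ Set.univ | rescale π S ∈ Av σ S.card} |
      rescale π Sᶜ ∈ Av σ Sᶜ.card} := fun π hπ =>
    ⟨⟨trivial, fun h => hπ (contains_of_contains_rescale h)⟩,
      fun h => hπ (contains_of_contains_rescale h)⟩
  have h4 := Set.ncard_le_ncard h3 (Set.toFinite _)
  rw [avoidProb, div_le_iff₀ (by positivity), mul_assoc, ← h2]
  exact_mod_cast h4

/-- The proportion of permutations avoiding a pattern decays exponentially. -/
theorem exists_avoidProb_le {s : ℕ} (σ : Equiv.Perm (Fin s)) :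
    ∃ C r : ℝ, 0 < r ∧ r < 1 ∧ ∀ n, avoidProb σ n ≤ C * r ^ n := by
  rcases Nat.eq_zero_or_pos s with rfl | hs
  · refine ⟨0, 1 / 2, by norm_num, by norm_num, fun n => ?_⟩
    have : Av σ n = ∅ := by
      ext π
      simp only [Av, Set.mem_ofPred_eq, Set.mem_empty_iff_false, iff_false, not_not]
      exact ⟨Fin.elim0, fun i => i.elim0, fun i => i.elim0⟩
    simp [avoidProb, this]
  -- `avoidProb σ s` itself vanishes for `s = 1`, and `q` must be invertible. With `r` the `s`-th
  -- root of `q`, each block of length `s` costs `r ^ s = q`; the constant `q⁻¹` covers `n < s`.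
  · obtain ⟨q, hq0, hq1, hq⟩ : ∃ q : ℝ, 0 < q ∧ q < 1 ∧ avoidProb σ s ≤ q := by
      obtain ⟨q, h1, h2⟩ := exists_between (avoidProb_self_lt_one σ)
      exact ⟨q, (avoidProb_nonneg σ s).trans_lt h1, h2, h1.le⟩
    have hs' : (0 : ℝ) < s := by exact_mod_cast hs
    set r : ℝ := q ^ ((s : ℝ)⁻¹) with hr
    have hr0 : 0 < r := Real.rpow_pos_of_pos hq0 _
    have hr1 : r < 1 := Real.rpow_lt_one hq0.le hq1 (by positivity)
    have hrs : r ^ s = q := Real.rpow_inv_natCast_pow hq0.le hs.ne'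
    refine ⟨q⁻¹, r, hr0, hr1, fun n => ?_⟩
    induction n using Nat.strong_induction_on with
    | _ n ih =>
      rcases lt_or_ge n s with h | h
      · refine (avoidProb_le_one σ n).trans ?_
        rw [inv_mul_eq_div, one_le_div hq0, ← hrs]
        exact pow_le_pow_of_le_one hr0.le hr1.le h.le
      · obtain ⟨m, rfl⟩ := Nat.exists_eq_add_of_le' h
        calc avoidProb σ (m + s) ≤ avoidProb σ s * avoidProb σ m := avoidProb_add_le σ m s
          _ ≤ q * (q⁻¹ * r ^ m) :=
            mul_le_mul hq (ih m (by omega)) (avoidProb_nonneg σ m) hq0.le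
          _ = q⁻¹ * r ^ (m + s) := by rw [pow_add, hrs]; ring

theorem summable_mul_avoidProb {s : ℕ} (σ : Equiv.Perm (Fin s)) :
    Summable fun n : ℕ => (n : ℝ) * avoidProb σ n := by
  obtain ⟨C, r, hr0, hr1, h⟩ := exists_avoidProb_le σ
  have hs := (summable_pow_mul_geometric_of_norm_lt_one 1
    (show ‖r‖ < 1 by rwa [Real.norm_of_nonneg hr0.le])).mul_left C
  refine Summable.of_nonneg_of_le (fun n => mul_nonneg n.cast_nonneg (avoidProb_nonneg σ n))
    (fun n => ?_) hs
  calc (n : ℝ) * avoidProb σ n ≤ n * (C * r ^ n) := by gcongr; exact h n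
    _ = _ := by ring

theorem tendsto_sq_mul_avoidProb {s : ℕ} (σ : Equiv.Perm (Fin s)) :
    Tendsto (fun n : ℕ => (n : ℝ) ^ 2 * avoidProb σ n) atTop (𝓝 0) := by
  obtain ⟨C, r, hr0, hr1, h⟩ := exists_avoidProb_le σ
  have hs := ((summable_pow_mul_geometric_of_norm_lt_one 2
    (show ‖r‖ < 1 by rwa [Real.norm_of_nonneg hr0.le])).mul_left C).tendsto_atTop_zero
  refine squeeze_zero (fun n => mul_nonneg (by positivity) (avoidProb_nonneg σ n))
    (fun n => ?_) hs
  calc (n : ℝ) ^ 2 * avoidProb σ n ≤ n ^ 2 * (C * r ^ n) := by gcongr; exact h n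
    _ = _ := by ring

/-! ### The string generated by 2, and the exact count -/

theorem invariantOn_apply_eq_symm_mem {n : ℕ} {p : Fin n} (a b : Fin n) {S : Finset (Fin n)}
    (hp : p ∉ S) : InvariantOn S {π : Equiv.Perm (Fin n) | π p = a ∧ π.symm b ∈ S} := by
  intro g hg π
  have hmem : ∀ x, g x ∈ S ↔ x ∈ S := by
    intro x
    constructor
    · intro h
      by_contra hx
      exact hx (hg x hx ▸ h)
    · intro h
      by_contra hx
      rw [g.injective (hg _ hx)] at hx
      exact hx h
  have h2 : (π * g).symm b ∈ S ↔ π.symm b ∈ S := by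
    rw [← hmem ((π * g).symm b)]
    have : g ((π * g).symm b) = π.symm b := by
      rw [Equiv.eq_symm_apply, ← Equiv.Perm.mul_apply, Equiv.apply_symm_apply]
    rw [this]
  simp only [Set.mem_ofPred_eq, h2, Equiv.Perm.mul_apply, hg p hp]

theorem subPositions_two_eq {n : ℕ} {π : Equiv.Perm (Fin n)} {p q : Fin n}
    (hp : (π p : ℕ) = 0) (hq : (π q : ℕ) = 1) :
    subPositions π 2 = Finset.univ.filter fun j => p ∉ Finset.uIcc q j := by
  have h1 : ∀ l, 2 ≤ entry π l ↔ l ≠ p := by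
    intro l
    rw [← π.injective.ne_iff, Ne, Fin.ext_iff, hp, entry]
    omega
  have h2 : ∀ l, entry π l = 2 ↔ l = q := by
    intro l
    rw [← π.injective.eq_iff, Fin.ext_iff, hq, entry]
    omega
  ext j
  simp only [subPositions, h1, h2, Finset.mem_filter, Finset.mem_univ, true_and, exists_eq_left]
  exact ⟨fun h hpj => h p hpj rfl, fun h l hl hlp => h (hlp ▸ hl)⟩

theorem subPositions_two_of_lt {n : ℕ} {π : Equiv.Perm (Fin n)} {p q : Fin n}
    (hp : (π p : ℕ) = 0) (hq : (π q : ℕ) = 1) (hqp : q < p) :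
    subPositions π 2 = Finset.Iio p := by
  rw [subPositions_two_eq hp hq]
  ext j
  simp only [Finset.mem_filter, Finset.mem_univ, true_and, Finset.mem_Iio, Finset.mem_uIcc',
    Fin.le_def, Fin.lt_def] at *
  omega

theorem subPositions_two_of_gt {n : ℕ} {π : Equiv.Perm (Fin n)} {p q : Fin n}
    (hp : (π p : ℕ) = 0) (hq : (π q : ℕ) = 1) (hqp : p < q) :
    subPositions π 2 = Finset.Ioi p := by
  rw [subPositions_two_eq hp hq]
  ext j
  simp only [Finset.mem_filter, Finset.mem_univ, true_and, Finset.mem_Ioi, Finset.mem_uIcc',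
    Fin.le_def, Fin.lt_def] at *
  omega

theorem contains_subPerm_iff {s n k : ℕ} (σ : Equiv.Perm (Fin s)) {π : Equiv.Perm (Fin n)}
    {S : Finset (Fin n)} (h : subPositions π k = S) :
    Contains σ (subPerm π k) ↔ ¬ rescale π S ∈ Av σ S.card := by
  subst h
  simp [subPerm, Av]

/-- The two summands are the cases of 2 left and right of 1: a side of length `i` offers `i` places
for 2, and the proportion `avoidProb σ i` of its rescalings avoids `σ`. -/
theorem ncard_avoids_subPerm_two_apply_eq {s n : ℕ} (σ : Equiv.Perm (Fin s)) {a b : Fin n}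
    (ha : (a : ℕ) = 0) (hb : (b : ℕ) = 1) (p : Fin n) :
    ({π : Equiv.Perm (Fin n) | π p = a ∧ ¬ Contains σ (subPerm π 2)}.ncard : ℝ) =
      ((p : ℕ) * avoidProb σ p + (n - 1 - p : ℕ) * avoidProb σ (n - 1 - p)) *
        (n - 2).factorial := by
  have hab : a ≠ b := by rintro rfl; omega
  have hcount : ∀ S : Finset (Fin n), p ∉ S →
      ({π ∈ {π : Equiv.Perm (Fin n) | π p = a ∧ π.symm b ∈ S} |
        rescale π S ∈ Av σ S.card}.ncard : ℝ) =
      S.card * avoidProb σ S.card * (n - 2).factorial := by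
    intro S hp
    rw [ncard_rescale_mem_Av σ S _ (invariantOn_apply_eq_symm_mem a b hp),
      ncard_apply_eq_symm_mem hab S hp]
    push_cast
    ring
  have hsplit : {π : Equiv.Perm (Fin n) | π p = a ∧ ¬ Contains σ (subPerm π 2)} =
      {π ∈ {π : Equiv.Perm (Fin n) | π p = a ∧ π.symm b ∈ Finset.Iio p} |
        rescale π (Finset.Iio p) ∈ Av σ (Finset.Iio p).card} ∪
      {π ∈ {π : Equiv.Perm (Fin n) | π p = a ∧ π.symm b ∈ Finset.Ioi p} |
        rescale π (Finset.Ioi p) ∈ Av σ (Finset.Ioi p).card} := by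
    ext π
    simp only [Set.mem_union, Set.mem_ofPred_eq, Finset.mem_Iio, Finset.mem_Ioi]
    by_cases hp : π p = a
    · have hp0 : (π p : ℕ) = 0 := by rw [hp, ha]
      have hq1 : (π (π.symm b) : ℕ) = 1 := by rw [Equiv.apply_symm_apply, hb]
      rcases lt_trichotomy (π.symm b) p with h | h | h
      · rw [contains_subPerm_iff σ (subPositions_two_of_lt hp0 hq1 h)]
        simp [hp, h, h.not_gt]
      · rw [h] at hq1
        omega
      · rw [contains_subPerm_iff σ (subPositions_two_of_gt hp0 hq1 h)]
        simp [hp, h, h.not_gt]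
    · simp [hp]
  rw [hsplit, Set.ncard_union_eq, Nat.cast_add, hcount _ (by simp), hcount _ (by simp),
    Fin.card_Iio, Fin.card_Ioi]
  · ring
  · rw [Set.disjoint_left]
    rintro π ⟨⟨_, h1⟩, _⟩ ⟨⟨_, h2⟩, _⟩
    rw [Finset.mem_Iio] at h1
    rw [Finset.mem_Ioi] at h2
    exact h1.not_gt h2

theorem ncard_avoids_subPerm_two {s n : ℕ} (hn : 2 ≤ n) (σ : Equiv.Perm (Fin s)) :
    ({π : Equiv.Perm (Fin n) | ¬ Contains σ (subPerm π 2)}.ncard : ℝ) =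
      2 * (∑ i ∈ Finset.range n, (i : ℝ) * avoidProb σ i) * (n - 2).factorial := by
  let a : Fin n := ⟨0, by omega⟩
  let b : Fin n := ⟨1, by omega⟩
  have h : {π : Equiv.Perm (Fin n) | ¬ Contains σ (subPerm π 2)} =
      ⋃ p ∈ (Finset.univ : Finset (Fin n)),
        {π : Equiv.Perm (Fin n) | π p = a ∧ ¬ Contains σ (subPerm π 2)} := by
    ext π
    simp only [Set.mem_ofPred_eq, Set.mem_iUnion, exists_prop, Finset.mem_univ, true_and]
    exact ⟨fun h => ⟨π.symm a, by simp, h⟩, fun ⟨_, _, h⟩ => h⟩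
  have hdisj : ((Finset.univ : Finset (Fin n)) : Set (Fin n)).PairwiseDisjoint
      fun p => {π : Equiv.Perm (Fin n) | π p = a ∧ ¬ Contains σ (subPerm π 2)} := by
    intro q _ q' _ hne
    rw [Function.onFun, Set.disjoint_left]
    rintro π ⟨h1, _⟩ ⟨h2, _⟩
    exact hne (π.injective (h1.trans h2.symm))
  rw [h, ncard_biUnion_finset _ hdisj, Nat.cast_sum,
    Finset.sum_congr rfl fun p _ => ncard_avoids_subPerm_two_apply_eq σ (a := a) (b := b) rfl rfl p,
    ← Finset.sum_mul, Finset.sum_add_distrib,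
    Fin.sum_univ_eq_sum_range (fun i : ℕ => (i : ℝ) * avoidProb σ i),
    Fin.sum_univ_eq_sum_range (fun i : ℕ => ((n - 1 - i : ℕ) : ℝ) * avoidProb σ (n - 1 - i)),
    -- The reflection `i ↦ n - 1 - i` identifies the right-hand sum with the left-hand one, whence
    -- the factor 2.
    Finset.sum_range_reflect (fun i : ℕ => (i : ℝ) * avoidProb σ i)]
  ring

theorem prob_contains_and_avoids_subPerm_two {s n : ℕ} (hn : 2 ≤ n) (σ : Equiv.Perm (Fin s)) :
    prob {π : Equiv.Perm (Fin n) | Contains σ π ∧ ¬ Contains σ (subPerm π 2)} =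
      2 * (∑ i ∈ Finset.range n, (i : ℝ) * avoidProb σ i) / (n * (n - 1)) - avoidProb σ n := by
  have h1 : {π : Equiv.Perm (Fin n) | Contains σ π ∧ ¬ Contains σ (subPerm π 2)} =
      {π : Equiv.Perm (Fin n) | ¬ Contains σ (subPerm π 2)} \ Av σ n := by
    ext π
    simp [Av, and_comm]
  have h2 : Av σ n ⊆ {π : Equiv.Perm (Fin n) | ¬ Contains σ (subPerm π 2)} :=
    fun π hπ h => hπ (contains_of_contains_subPerm h)
  rw [prob, h1, Set.cast_ncard_sdiff h2 (Set.toFinite _), sub_div,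
    ncard_avoids_subPerm_two hn, avoidProb]
  congr 1
  obtain ⟨m, rfl⟩ := Nat.exists_eq_add_of_le' hn
  simp only [Nat.add_sub_cancel, Nat.factorial_succ]
  have h3 : ((m + 2 : ℕ) : ℝ) - 1 ≠ 0 := by
    rw [show ((m + 2 : ℕ) : ℝ) - 1 = m + 1 by push_cast; ring]
    positivity
  push_cast at h3 ⊢
  field_simp
  ring

/-- The rescaled string is a pattern of `π`, so the equivalence can fail in one direction only. -/
theorem compl_AvSub {s : ℕ} (σ : Equiv.Perm (Fin s)) (k n : ℕ) :
    (AvSub σ k n)ᶜ =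
      {π : Equiv.Perm (Fin n) | Contains σ π ∧ ¬ Contains σ (subPerm π k)} := by
  ext π
  have := contains_of_contains_subPerm (σ := σ) (π := π) (k := k)
  simp only [AvSub, Av, Set.mem_compl_iff, Set.mem_ofPred_eq]
  tauto

/-! ### Asymptotics -/

theorem tendsto_sq_mul_prob {s : ℕ} (σ : Equiv.Perm (Fin s)) :
    Tendsto (fun n : ℕ => (n : ℝ) ^ 2 *
        prob {π : Equiv.Perm (Fin n) | Contains σ π ∧ ¬ Contains σ (subPerm π 2)})
      atTop (𝓝 (2 * ∑' i : ℕ, (i : ℝ) * avoidProb σ i)) := by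
  have h1 := (summable_mul_avoidProb σ).hasSum.tendsto_sum_nat
  have h2 : Tendsto (fun n : ℕ => (n : ℝ) / (n + (-1 : ℝ))) atTop (𝓝 1) :=
    tendsto_natCast_div_add_atTop (-1 : ℝ)
  have h3 := ((h1.const_mul 2).mul h2).sub (tendsto_sq_mul_avoidProb σ)
  rw [mul_one, sub_zero] at h3
  refine h3.congr' ?_
  filter_upwards [eventually_ge_atTop 2] with n hn
  rw [prob_contains_and_avoids_subPerm_two hn]
  have hn' : (2 : ℝ) ≤ n := by exact_mod_cast hn
  have h4 : (n : ℝ) ≠ 0 := by positivity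
  have h5 : (n : ℝ) - 1 ≠ 0 := by linarith
  rw [← sub_eq_add_neg]
  field_simp

theorem subPositions_two_nonempty {n : ℕ} (hn : 2 ≤ n) (π : Equiv.Perm (Fin n)) :
    (subPositions π 2).Nonempty := by
  refine ⟨π.symm ⟨1, hn⟩, ?_⟩
  simp only [subPositions, Finset.mem_filter, Finset.mem_univ, true_and]
  exact ⟨π.symm ⟨1, hn⟩, by simp [entry], by simp [entry]⟩

theorem mul_avoidProb_eq_zero {s : ℕ} (hs : s ≤ 1) (σ : Equiv.Perm (Fin s)) (i : ℕ) :
    (i : ℝ) * avoidProb σ i = 0 := by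
  rcases Nat.eq_zero_or_pos i with rfl | hi
  · simp
  · have : Av σ i = ∅ := by
      ext π
      simpa [Av] using contains_of_le_one hs hi σ π
    simp [avoidProb, this]

theorem tsum_mul_avoidProb_pos {s : ℕ} (hs : 1 < s) (σ : Equiv.Perm (Fin s)) :
    0 < ∑' i : ℕ, (i : ℝ) * avoidProb σ i := by
  -- The term `i = 1` suffices: one entry cannot contain a longer pattern.
  refine (summable_mul_avoidProb σ).tsum_pos
    (fun i => mul_nonneg i.cast_nonneg (avoidProb_nonneg σ i)) 1 ?_
  have : (1 : Equiv.Perm (Fin 1)) ∈ Av σ 1 := by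
    rintro ⟨f, hf, _⟩
    have := Fintype.card_le_of_injective f hf.injective
    simp only [Fintype.card_fin] at this
    omega
  have h : 0 < (Av σ 1).ncard := (Set.ncard_pos (Set.toFinite _)).2 ⟨_, this⟩
  simpa [avoidProb] using h

theorem isEquivalent_prob {s : ℕ} (σ : Equiv.Perm (Fin s)) :
    Asymptotics.IsEquivalent atTop
      (fun n : ℕ => prob {π : Equiv.Perm (Fin n) | Contains σ π ∧ ¬ Contains σ (subPerm π 2)})
      (fun n : ℕ => 2 * (∑' i : ℕ, (i : ℝ) * avoidProb σ i) / (n : ℝ) ^ 2) := by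
  -- For `s ≤ 1` the limit constant is 0, and equivalence to 0 requires exact eventual vanishing; it
  -- holds since the string of 2 is nonempty and so contains `σ`. For `s > 1` the constant is
  -- positive and can be divided by.
  rcases le_or_gt s 1 with hs | hs
  · simp only [mul_avoidProb_eq_zero hs, tsum_zero, mul_zero, zero_div]
    refine (Asymptotics.isEquivalent_zero_iff_eventually_zero).2 ?_
    filter_upwards [eventually_ge_atTop 2] with n hn
    have : {π : Equiv.Perm (Fin n) | Contains σ π ∧ ¬ Contains σ (subPerm π 2)} = ∅ := by
      ext π
      simp [contains_of_le_one hs (subPositions_two_nonempty hn π).card_pos σ (subPerm π 2)]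
    simp [prob, this]
  · have h0 := (tsum_mul_avoidProb_pos hs σ).ne'
    rw [Asymptotics.isEquivalent_iff_tendsto_one]
    · have h1 := (tendsto_sq_mul_prob σ).div_const (2 * ∑' i : ℕ, (i : ℝ) * avoidProb σ i)
      rw [div_self (by positivity)] at h1
      refine h1.congr fun n => ?_
      rw [Pi.div_apply, div_div_eq_mul_div, mul_comm]
    · filter_upwards [eventually_ge_atTop 1] with n hn
      positivity

theorem tendsto_sum_ncard_Av {s : ℕ} (σ : Equiv.Perm (Fin s)) :
    Tendsto (fun n : ℕ => ∑ i ∈ Finset.Icc 1 (n - 1 - s),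
        ((Av σ i).ncard : ℝ) / (Nat.factorial (i - 1) : ℝ))
      atTop (𝓝 (∑' i : ℕ, (i : ℝ) * avoidProb σ i)) := by
  have h1 := (summable_mul_avoidProb σ).hasSum.tendsto_sum_nat
  have h2 : Tendsto (fun n : ℕ => n - 1 - s + 1) atTop atTop :=
    (tendsto_add_atTop_nat 1).comp ((tendsto_sub_atTop_nat s).comp (tendsto_sub_atTop_nat 1))
  refine (h1.comp h2).congr fun n => ?_
  -- The series has a zero term at `i = 0`, so it can start at 1, where `i / i! = 1 / (i - 1)!`.
  rw [Function.comp_apply, Finset.sum_range_succ', Nat.cast_zero, zero_mul, add_zero,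
    Finset.range_eq_Ico, Finset.sum_Ico_add' (fun i : ℕ => (i : ℝ) * avoidProb σ i) 0 _ 1]
  refine Finset.sum_congr (by ext; simp) fun i hi => ?_
  obtain ⟨j, rfl⟩ := Nat.exists_eq_add_of_le' (Finset.mem_Icc.1 hi).1
  rw [avoidProb, Nat.add_sub_cancel, Nat.factorial_succ]
  push_cast
  field_simp

end SubPerm

theorem mainTheorem6 {s : ℕ} (σ : Equiv.Perm (Fin s)) :
    ∃ h : ℝ,
      Filter.Tendsto
        (fun n : ℕ => ∑ i ∈ Finset.Icc 1 (n - 1 - s),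
          ((SubPerm.Av σ i).ncard : ℝ) / (Nat.factorial (i - 1) : ℝ))
        Filter.atTop (nhds h) ∧
      Asymptotics.IsEquivalent Filter.atTop
        (fun n : ℕ => SubPerm.prob (SubPerm.AvSub σ 2 n)ᶜ)
        (fun n : ℕ => 2 * h / (n : ℝ) ^ 2) ∧
      Asymptotics.IsEquivalent Filter.atTop
        (fun n : ℕ => SubPerm.prob
          {π : Equiv.Perm (Fin n) | SubPerm.Contains σ π ∧ ¬ SubPerm.Contains σ (SubPerm.subPerm π 2)})
        (fun n : ℕ => 2 * h / (n : ℝ) ^ 2) := by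
  refine ⟨_, SubPerm.tendsto_sum_ncard_Av σ, ?_, SubPerm.isEquivalent_prob σ⟩
  simp only [SubPerm.compl_AvSub]
  exact SubPerm.isEquivalent_prob σ
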